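/- **Theorem 1.2.** Let $V=\mathbb F_2^m$ and let $C=RM(1,m)=\{(\lambda(x)+b)_{x\in V}\mid \lambda\in V^*,\ b\in\mathbb F_2\}\subset\mathbb F_2^V$ be the first-order Reed–Muller code, with dual code $C^\perp=\{y\in\mathbb F_2^V\mid \sum_{v}x_vy_v=0\text{ for all }x\in C\}$. Let $U\subset V$ be a three-dimensional subspace (so $m\ge 3$), and let $H_8=\{a\in\mathbb F_2^U\mid \sum_{u\in U}a_u=0,\ \sum_{u\in U}a_u u=0\}$ be the extended Hamming code of length $8$ with coordinates indexed by $U$. For a function $f$ on the set $\binom Vk$ of $k$-subsets of $V$ with real values, put $\widetilde f(S)=\sum_{z\in\binom{V}{k},\,z\subset S}f(z)$ for $S\subset V$, and write $\widetilde f(c)=\widetilde f(\mathrm{supp}(c))$ for a word $c$; $f$ is called harmonic of degree $k$ if $\sum_{z\in\binom Vk,\,z\supset y}f(z)=0$ for all $y\in\binom V{k-1}$. For a harmonic $f$ of degree $k$ and a code $D\subset\mathbb F_2^V$ let $$w_{D,f}(x,y)=\sum_{c\in D}\widetilde f(c)\,x^{2^m-\mathrm{wt}(c)}y^{\mathrm{wt}(c)}.$$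 Let $k\ge 1$ and let $f$ be a harmonic function of degree $k$ such that $f=0$ on $\binom Vk\setminus\binom Uk$. Then, as polynomials in $x,y$, $$w_{C,f}(x,y)=2^{m-3}x^{2^{m-1}}y^{2^{m-1}}\sum_{a\in H_8,\ \mathrm{wt}(a)=4}\widetilde f(a),$$ $$w_{C^\perp,f}(x,y)=(-1)^k(xy)^k\,2^{2^{m-1}-4}\left(\frac{x+y}{\sqrt2}\right)^{2^{m-1}-k}\left(\frac{x-y}{\sqrt2}\right)^{2^{m-1}-k}\sum_{a\in H_8,\ \mathrm{wt}(a)=4}\widetilde f(a),$$ where for $k>2^{m-1}$ (in that case $f=0$) the last right-hand side is read as $0$. -/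

import Mathlib

namespace RMHarm

/-- The support of a binary word with coordinates indexed by `Ω`. -/
def supp {Ω : Type*} [Fintype Ω] (c : Ω → ZMod 2) : Finset Ω :=
  {i | c i ≠ 0}

/-- The dual code `C^⊥` of a binary linear code with coordinates indexed by `Ω`. -/
def dualCode {Ω : Type*} [Fintype Ω] (C : Submodule (ZMod 2) (Ω → ZMod 2)) :
    Submodule (ZMod 2) (Ω → ZMod 2) where
  carrier := {y | ∀ x ∈ C, ∑ i, x i * y i = 0}
  zero_mem' := by intro x _; simp
  add_mem' := by
    intro a b ha hb x hx
    simp [mul_add, Finset.sum_add_distrib, ha x hx, hb x hx]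
  smul_mem' := by
    intro r a ha x hx
    have h := ha x hx
    simp only [Pi.smul_apply, smul_eq_mul, mul_left_comm _ r, ← Finset.mul_sum, h, mul_zero]

/-- The first-order Reed--Muller code `RM(1,m)`, with coordinates indexed by `V = 𝔽₂^m`:
the words `(lam x + b)_{x ∈ V}` with `lam` a linear form on `V` and `b ∈ 𝔽₂`. -/
def RM1 (m : ℕ) : Submodule (ZMod 2) ((Fin m → ZMod 2) → ZMod 2) where
  carrier := {c | ∃ (lam : Module.Dual (ZMod 2) (Fin m → ZMod 2)) (b : ZMod 2),
    c = fun x => lam x + b}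
  zero_mem' := ⟨0, 0, by ext; simp⟩
  add_mem' := by
    rintro _ _ ⟨l, b, rfl⟩ ⟨l', b', rfl⟩
    exact ⟨l + l', b + b', by ext; simp [add_add_add_comm]⟩
  smul_mem' := by
    rintro r _ ⟨l, b, rfl⟩
    exact ⟨r • l, r * b, by ext; simp [mul_add]⟩

/-- The extended Hamming code with coordinates indexed by a finite `𝔽₂`-vector space `W`
(so it is `H_{2^d}` when `dim W = d`). The coordinates `w ≠ 0` carry the Hamming code, whose
parity check matrix has the nonzero vectors `w` as its columns, and the coordinate `0` carries
the overall parity bit. -/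
def extHamming (W : Type*) [Fintype W] [AddCommGroup W] [Module (ZMod 2) W] :
    Submodule (ZMod 2) (W → ZMod 2) where
  carrier := {c | ∑ w, c w = 0 ∧ ∑ w, c w • w = 0}
  zero_mem' := by simp
  add_mem' := by
    rintro a b ⟨ha, ha'⟩ ⟨hb, hb'⟩
    simp [add_smul, Finset.sum_add_distrib, ha, ha', hb, hb']
  smul_mem' := by
    rintro r a ⟨ha, ha'⟩
    simp only [Set.mem_ofPred_eq, Pi.smul_apply, smul_eq_mul, mul_smul, ← Finset.mul_sum,
      ← Finset.smul_sum, ha, ha', mul_zero, smul_zero, and_self]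

/-- `ℝX_k`, as a subspace of the space `ℝX` of real functions on the set `X` of all subsets
of `Ω`: the functions supported on the `k`-subsets. -/
def RX (Ω : Type*) (k : ℕ) : Submodule ℝ (Finset Ω → ℝ) where
  carrier := {f | ∀ z : Finset Ω, z.card ≠ k → f z = 0}
  zero_mem' := by intro z _; rfl
  add_mem' := by intro a b ha hb z hz; simp [ha z hz, hb z hz]
  smul_mem' := by intro r a ha z hz; simp [ha z hz]

open Classical in
/-- The differentiation `γ` on `ℝX`: the linear extension of
`z ↦ ∑ y`, over the subsets `y` of `z` with one element less. -/
noncomputable def gamma (Ω : Type*) [Fintype Ω] :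
    (Finset Ω → ℝ) →ₗ[ℝ] (Finset Ω → ℝ) :=
  Fintype.linearCombination ℝ
    (fun z : Finset Ω => ∑ y ∈ z.powerset with y.card + 1 = z.card, Pi.single y (1 : ℝ))

/-- `Harm_k`, the space of harmonic functions of degree `k`: the kernel of `γ` on `ℝX_k`. -/
noncomputable def Harm (Ω : Type*) [Fintype Ω] (k : ℕ) : Submodule ℝ (Finset Ω → ℝ) :=
  RX Ω k ⊓ LinearMap.ker (gamma Ω)

/-- The extension `f̃(u) = ∑ f(z)`, over the `k`-subsets `z` of `u`, of `f ∈ ℝX_k`. -/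
noncomputable def tilde {Ω : Type*} (k : ℕ) (f : Finset Ω → ℝ) (u : Finset Ω) : ℝ :=
  ∑ z ∈ u.powersetCard k, f z

open Classical in
/-- The harmonic weight enumerator `w_{C,f}(x,y)` of a binary linear code `C` of length `|Ω|`
and of `f ∈ Harm_k`, a real polynomial in `x = X 0` and `y = X 1`. -/
noncomputable def harmWE {Ω : Type*} [Fintype Ω] (C : Submodule (ZMod 2) (Ω → ZMod 2))
    (k : ℕ) (f : Finset Ω → ℝ) : MvPolynomial (Fin 2) ℝ :=
  ∑ c : Ω → ZMod 2 with c ∈ C,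
    MvPolynomial.C (tilde k f (supp c)) *
      MvPolynomial.X 0 ^ (Fintype.card Ω - hammingNorm c) * MvPolynomial.X 1 ^ hammingNorm c

open Classical in
/-- The sum of `f̃(a)` over the words `a` of weight `4` in the extended Hamming code
(which is `H_8` when `dim U = 3`) whose coordinates are indexed by the subspace `U` of `V`. -/
noncomputable def hammingSum {V : Type*} [AddCommGroup V] [Module (ZMod 2) V]
    (U : Submodule (ZMod 2) V) [Fintype U] (k : ℕ) (f : Finset V → ℝ) : ℝ :=
  ∑ a : U → ZMod 2 with a ∈ extHamming U ∧ hammingNorm a = 4,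
    tilde k f ((supp a).map (Function.Embedding.subtype (fun v => v ∈ U)))

end RMHarm

/-! Two independent facts combine. First, harmonicity of `f` forces the sum of `f` over the `k`-sets
meeting `u` in `j` points to be `(-1)^(k-j) * choose k j * f̃(u)` (`interSum_eq`). Hence the
character transform of `v ↦ f̃(v) x^(n - wt v) y^(wt v)` is again `f̃` times an explicit product
(`sum_sgn_mul_tilde`), and Poisson summation gives a MacWilliams identity
(`natCard_mul_harmWE_dualCode`).

Second, constant words of `RM(1,m)` have `f̃ = 0`, and all others have weight `2^(m-1)`, so both
enumerators reduce to the single number `∑ f̃(c)`. As `f` lives on `U`, `f̃(c)` depends only on the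
restriction of `c` to `U`. Each affine function on `U` arises from `2^(m-3)` affine functions on
`V`, and the affine functions on a three-dimensional space are exactly the words of `H_8`, the
nonconstant ones having weight 4 (`sum_tilde_affineWord`). -/

namespace RMHarm

open Finset

/-! ### Harmonic functions and intersection sizes -/

section Harmonic

variable {Ω : Type*}

/-- The sum of `f` over the `k`-subsets that meet `u` in exactly `j` points. -/
noncomputable def interSum [Fintype Ω] [DecidableEq Ω] (k : ℕ) (f : Finset Ω → ℝ) (u : Finset Ω) (j : ℕ) : ℝ :=
  ∑ z : Finset Ω with z.card = k ∧ (z ∩ u).card = j, f z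

/-- The adjoint of `gamma`: once `γ f = 0`, each test function `φ` gives a linear relation among the
values of `f`. -/
lemma sum_mul_gamma [Fintype Ω] [DecidableEq Ω] (f φ : Finset Ω → ℝ) :
    ∑ y, φ y * gamma Ω f y = ∑ z, f z * ∑ x ∈ z, φ (z.erase x) := by
  classical
  have h : ∀ z : Finset Ω, ∑ x ∈ z, φ (z.erase x)
      = ∑ y ∈ z.powerset with y.card + 1 = z.card, φ y := by
    intro z
    refine Finset.sum_bij (fun x _ => z.erase x) ?_ ?_ ?_ ?_
    · intro x hx
      simp only [mem_filter, mem_powerset]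
      exact ⟨erase_subset _ _, card_erase_add_one hx⟩
    · intro x hx x' hx' h
      exact Finset.erase_injOn z hx hx' h
    · intro y hy
      simp only [mem_filter, mem_powerset] at hy
      obtain ⟨x, hx, rfl⟩ := (Finset.covBy_iff_exists_erase.mp
        (Finset.covBy_iff_card_sdiff_eq_one.mpr ⟨hy.1, by
          rw [card_sdiff_of_subset hy.1]; omega⟩))
      exact ⟨x, hx, rfl⟩
    · intros; rfl
  simp only [h, gamma, Fintype.linearCombination_apply, Finset.sum_apply, Pi.smul_apply,
    smul_eq_mul, Finset.mul_sum]
  rw [Finset.sum_comm]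
  refine Finset.sum_congr rfl fun z _ => ?_
  rw [Finset.sum_comm]
  have : ∀ y' ∈ z.powerset.filter (fun y => y.card + 1 = z.card),
      ∑ y, φ y * (f z * (Pi.single y' (1 : ℝ) : Finset Ω → ℝ) y) = f z * φ y' := by
    intro y' _
    rw [Finset.sum_eq_single y']
    · simp; ring
    · intro b _ hb; simp [hb]
    · simp
  convert Finset.sum_congr rfl this

/-- Test `γ f = 0` against the indicator of `|y ∩ u| = j`. Such a `y` arises from a `k`-set `z` by
deleting one of `k - j` points outside `u` when `|z ∩ u| = j`, or one of `j + 1` points inside `u`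
when `|z ∩ u| = j + 1`. -/
lemma interSum_succ [Fintype Ω] [DecidableEq Ω] {k : ℕ} {f : Finset Ω → ℝ} (hf : f ∈ Harm Ω k) (u : Finset Ω) (j : ℕ) :
    ((k : ℝ) - j) * interSum k f u j + (j + 1) * interSum k f u (j + 1) = 0 := by
  have h0 := sum_mul_gamma f (fun y => if (y ∩ u).card = j then 1 else 0)
  have hγ : gamma Ω f = 0 := hf.2
  have hX : ∀ z : Finset Ω, z.card ≠ k → f z = 0 := hf.1
  simp only [hγ, Pi.zero_apply, mul_zero, Finset.sum_const_zero] at h0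
  rw [h0, interSum, interSum, Finset.sum_filter, Finset.sum_filter, Finset.mul_sum,
    Finset.mul_sum, ← Finset.sum_add_distrib]
  refine Finset.sum_congr rfl fun z _ => ?_
  by_cases hz : z.card = k
  swap
  · simp [hX z hz]
  have hin : ∀ x ∈ z ∩ u, ((z.erase x) ∩ u).card + 1 = (z ∩ u).card := by
    intro x hx
    rw [Finset.erase_inter]
    exact card_erase_add_one hx
  have hout : ∀ x ∈ z \ u, ((z.erase x) ∩ u).card = (z ∩ u).card := by
    intro x hx
    rw [Finset.erase_inter, Finset.erase_eq_of_notMem]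
    simp only [mem_sdiff] at hx
    simp [hx.2]
  have hcard : (z \ u).card + (z ∩ u).card = z.card := card_sdiff_add_card_inter z u
  have hsplit : ∑ x ∈ z, (if ((z.erase x) ∩ u).card = j then (1 : ℝ) else 0)
      = (z \ u).card * (if (z ∩ u).card = j then 1 else 0)
        + (z ∩ u).card * (if (z ∩ u).card = j + 1 then 1 else 0) := by
    rw [← Finset.sum_inter_add_sum_sdiff z u, add_comm]
    congr 1
    · rw [Finset.sum_congr rfl (fun x hx => by rw [hout x hx]), Finset.sum_const, nsmul_eq_mul]
    · rw [Finset.sum_congr rfl (g := fun _ => if (z ∩ u).card = j + 1 then (1 : ℝ) else 0),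
        Finset.sum_const, nsmul_eq_mul]
      intro x hx
      have := hin x hx
      congr 1
      simp only [eq_iff_iff]
      omega
  rw [hsplit]
  have hc : ((z \ u).card : ℝ) = k - (z ∩ u).card := by
    rw [← hz, ← hcard]; push_cast; ring
  rw [hc]
  simp only [hz, true_and]
  by_cases h1 : (z ∩ u).card = j
  · simp [h1]; ring
  · by_cases h2 : (z ∩ u).card = j + 1
    · simp [h2]; ring
    · simp [h1, h2]

lemma tilde_eq_sum [Fintype Ω] [DecidableEq Ω] (k : ℕ) (f : Finset Ω → ℝ) (u : Finset Ω) :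
    tilde k f u = ∑ z : Finset Ω with z.card = k ∧ z ⊆ u, f z := by
  classical
  rw [tilde]
  congr 1
  ext z
  simp [mem_powersetCard, and_comm]

lemma interSum_self [Fintype Ω] [DecidableEq Ω] (k : ℕ) (f : Finset Ω → ℝ) (u : Finset Ω) :
    interSum k f u k = tilde k f u := by
  rw [tilde_eq_sum, interSum]
  congr 1
  ext z
  simp only [mem_filter, mem_univ, true_and]
  refine and_congr_right fun hz => ?_
  rw [← hz, ← Finset.inter_eq_left]
  exact ⟨fun h => Finset.eq_of_subset_of_card_le inter_subset_left h.ge, fun h => by rw [h]⟩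

/-- Descend from `j = k`, where the sum is `f̃(u)`, by the recursion `interSum_succ`; its
coefficient `k - j` is nonzero for `j < k`. -/
lemma interSum_eq [Fintype Ω] [DecidableEq Ω] {k : ℕ} {f : Finset Ω → ℝ} (hf : f ∈ Harm Ω k) (u : Finset Ω) (i : ℕ) :
    ∀ j, i + j = k → interSum k f u j = (-1) ^ i * k.choose j * tilde k f u := by
  induction i with
  | zero =>
    intro j hj
    obtain rfl : j = k := by omega
    simp [interSum_self]
  | succ i ih =>
    intro j hj
    have h1 := interSum_succ hf u j
    rw [ih (j + 1) (by omega)] at h1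
    have h2 : (k.choose (j + 1) : ℝ) * (j + 1) = k.choose j * (k - j) := by
      have := Nat.choose_succ_right_eq k j
      rw [← Nat.cast_sub (by omega)]
      exact_mod_cast this
    have h3 : (k : ℝ) - j ≠ 0 := by
      rw [← Nat.cast_sub (by omega), Nat.cast_ne_zero]; omega
    apply mul_left_cancel₀ h3
    rw [pow_succ]
    linear_combination h1 - (-1) ^ i * tilde k f u * h2

lemma tilde_eq_zero_of_card_lt {k : ℕ} (f : Finset Ω → ℝ) {u : Finset Ω} (h : u.card < k) :
    tilde k f u = 0 := by
  rw [tilde, Finset.powersetCard_eq_empty.mpr h, Finset.sum_empty]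

/-- Up to sign, `f̃(u)` is the sum of `f` over the `k`-sets disjoint from `u` (the case `j = 0`),
and here there are none. -/
lemma tilde_eq_zero_of_card_compl_lt [Fintype Ω] [DecidableEq Ω] {k : ℕ} {f : Finset Ω → ℝ} (hf : f ∈ Harm Ω k)
    {u : Finset Ω} (h : uᶜ.card < k) : tilde k f u = 0 := by
  have h1 := interSum_eq hf u k 0 rfl
  have h2 : interSum k f u 0 = 0 := by
    rw [interSum, Finset.filter_eq_empty_iff.mpr, Finset.sum_empty]
    rintro z - ⟨h3, h4⟩
    rw [Finset.card_eq_zero, ← Finset.disjoint_iff_inter_eq_empty] at h4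
    have := Finset.card_le_card (Finset.subset_compl_iff_disjoint_right.mpr h4)
    omega
  rw [h2] at h1
  simpa using h1.symm

lemma tilde_univ [Fintype Ω] {k : ℕ} (hk : 1 ≤ k) {f : Finset Ω → ℝ} (hf : f ∈ Harm Ω k) :
    tilde k f univ = 0 := by
  classical
  exact tilde_eq_zero_of_card_compl_lt hf (by simp; omega)

lemma sum_mul_inter_card [Fintype Ω] [DecidableEq Ω] {k : ℕ} {f : Finset Ω → ℝ} (hf : f ∈ Harm Ω k) (u : Finset Ω)
    {A : Type*} [CommRing A] [Algebra ℝ A] (F : ℕ → A) :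
    ∑ z : Finset Ω with z.card = k, algebraMap ℝ A (f z) * F (z ∩ u).card =
      algebraMap ℝ A (tilde k f u) *
        ∑ j ∈ range (k + 1), (-1) ^ (k - j) * (k.choose j : A) * F j := by
  have hmaps : ∀ z ∈ (univ.filter fun z : Finset Ω => z.card = k),
      (z ∩ u).card ∈ range (k + 1) := by
    intro z hz
    simp only [mem_filter, mem_univ, true_and] at hz
    rw [mem_range, ← hz]
    exact Nat.lt_succ_of_le (card_le_card inter_subset_left)
  rw [← Finset.sum_fiberwise_of_maps_to hmaps, Finset.mul_sum]
  refine Finset.sum_congr rfl fun j hj => ?_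
  have hj' := mem_range.mp hj
  have h := congrArg (algebraMap ℝ A) (interSum_eq hf u (k - j) j (by omega))
  simp only [map_mul, map_pow, map_neg, map_one, map_natCast] at h
  rw [mul_comm (algebraMap ℝ A _), mul_right_comm, ← h, interSum, map_sum, Finset.sum_mul,
    Finset.filter_filter]
  refine Finset.sum_congr rfl fun z hz => ?_
  rw [(mem_filter.mp hz).2.2]

end Harmonic

end RMHarm

namespace RMHarm

open Finset

/-! ### The sign character of `𝔽₂` -/

section Characters

/-- The nontrivial character of `𝔽₂`, with values in a commutative ring. -/
def sgn (A : Type*) [CommRing A] (a : ZMod 2) : A := if a = 0 then 1 else -1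

variable {A : Type*} [CommRing A]

@[simp] lemma sgn_zero : sgn A 0 = 1 := if_pos rfl

lemma sgn_of_ne_zero {a : ZMod 2} (ha : a ≠ 0) : sgn A a = -1 := if_neg ha

lemma sgn_add (a b : ZMod 2) : sgn A (a + b) = sgn A a * sgn A b := by
  have h1 : ∀ a b : ZMod 2, a ≠ 0 → b ≠ 0 → a + b = 0 := by decide
  rcases eq_or_ne a 0 with rfl | ha
  · simp
  · rcases eq_or_ne b 0 with rfl | hb
    · simp
    · rw [h1 a b ha hb, sgn_of_ne_zero ha, sgn_of_ne_zero hb, sgn_zero, neg_one_mul, neg_neg]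

lemma sgn_sum {ι : Type*} (s : Finset ι) (g : ι → ZMod 2) :
    sgn A (∑ i ∈ s, g i) = ∏ i ∈ s, sgn A (g i) := by
  classical
  induction s using Finset.induction_on with
  | empty => simp
  | insert a s ha ih => rw [sum_insert ha, prod_insert ha, sgn_add, ih]

end Characters

/-! ### Character transform and Poisson summation -/

section Transform

variable {Ω : Type*} [Fintype Ω]

lemma mem_supp {c : Ω → ZMod 2} {i : Ω} : i ∈ supp c ↔ c i ≠ 0 := by simp [supp]

lemma card_supp (c : Ω → ZMod 2) : (supp c).card = hammingNorm c := rfl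

open Classical in
-- The summand factors over coordinates: `v i = 0` contributes `x`, or `0` if `i ∈ z`, while `v i =
-- 1` contributes `sgn (u i) * y`.
lemma sum_sgn_mul_eq_prod {A : Type*} [CommRing A] (u : Ω → ZMod 2) (z : Finset Ω) (x y : A) :
    ∑ v : Ω → ZMod 2, sgn A (∑ i, u i * v i) *
        (if z ⊆ supp v then x ^ (Fintype.card Ω - hammingNorm v) * y ^ hammingNorm v else 0) =
      ∏ i, ((if i ∈ z then 0 else x) + sgn A (u i) * y) := by
  have h2 : (univ : Finset (ZMod 2)) = {0, 1} := rfl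
  have h10 : (1 : ZMod 2) ≠ 0 := by decide
  have key : ∏ i : Ω, ((if i ∈ z then 0 else x) + sgn A (u i) * y) =
      ∏ i : Ω, ∑ a : ZMod 2, sgn A (u i * a) * (if a = 0 then (if i ∈ z then 0 else x) else y) := by
    refine prod_congr rfl fun i _ => ?_
    rw [h2, sum_pair h10.symm]
    simp [h10]
  rw [key, Finset.prod_univ_sum, Fintype.piFinset_univ]
  refine Finset.sum_congr rfl fun v _ => ?_
  rw [prod_mul_distrib, sgn_sum]
  congr 1
  rw [Finset.prod_ite, prod_const]
  have hy : (univ.filter fun i => ¬ v i = 0).card = hammingNorm v := rfl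
  have hx : (univ.filter fun i => v i = 0).card = Fintype.card Ω - hammingNorm v := by
    rw [← hy, ← Finset.card_univ,
      ← Finset.card_filter_add_card_filter_not (s := (univ : Finset Ω)) (fun i => v i = 0)]
    omega
  rw [hy]
  split_ifs with hz
  · rw [← hx, ← prod_const]
    congr 1
    refine prod_congr rfl fun i hi => ?_
    rw [if_neg]
    intro hiz
    exact mem_supp.mp (hz hiz) (mem_filter.mp hi).2
  · obtain ⟨i, hiz, hi⟩ := Finset.not_subset.mp hz
    rw [prod_eq_zero (i := i), zero_mul]
    · simpa [mem_supp] using hi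
    · simp [hiz]

open Classical in
-- Membership in `z` and in `supp u` gives four kinds of coordinates, with factors `-y`, `y`, `x -
-- y`, `x + y`. Only `|z ∩ supp u|` matters once `|z|` is fixed.
lemma prod_eq_pow {A : Type*} [CommRing A] (u : Ω → ZMod 2) (z : Finset Ω) (x y : A) :
    ∏ i, ((if i ∈ z then 0 else x) + sgn A (u i) * y) =
      (-y) ^ (z ∩ supp u).card * y ^ (z.card - (z ∩ supp u).card) *
        ((x - y) ^ (hammingNorm u - (z ∩ supp u).card) *
          (x + y) ^ (Fintype.card Ω - hammingNorm u - (z.card - (z ∩ supp u).card))) := by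
  have hs := card_supp u
  have e1 : (z \ supp u).card = z.card - (z ∩ supp u).card := by
    rw [← card_sdiff_add_card_inter z (supp u)]; omega
  have e2 : (supp u \ z).card = hammingNorm u - (z ∩ supp u).card := by
    rw [← hs, ← card_sdiff_add_card_inter (supp u) z, inter_comm]; omega
  have e3 : ((zᶜ) \ supp u).card =
      Fintype.card Ω - hammingNorm u - (z.card - (z ∩ supp u).card) := by
    have := card_union_add_card_inter z (supp u)
    have h : (zᶜ) \ supp u = (z ∪ supp u)ᶜ := by ext; simp
    rw [h, card_compl]
    have h1 : (z ∩ supp u).card ≤ z.card := card_le_card inter_subset_left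
    omega
  have e4 : zᶜ ∩ supp u = supp u \ z := by ext; simp [and_comm]
  rw [← Finset.prod_mul_prod_compl z, ← Finset.prod_inter_mul_prod_sdiff z (supp u),
    ← Finset.prod_inter_mul_prod_sdiff zᶜ (supp u), ← e3, ← e1, e4, ← e2]
  simp only [← prod_const]
  congr 1 <;> congr 1 <;> refine prod_congr rfl fun i hi => ?_ <;>
    simp only [mem_inter, mem_sdiff, mem_compl, mem_supp, not_not] at hi
  · rw [if_pos hi.1, sgn_of_ne_zero hi.2]; ring
  · rw [if_pos hi.1, hi.2, sgn_zero]; ring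
  · rw [if_neg hi.2, sgn_of_ne_zero hi.1]; ring
  · rw [if_neg hi.1, hi.2, sgn_zero]; ring

open Classical in
/-- The character transform of `v ↦ f̃(v) x^(n - wt v) y^(wt v)`, for harmonic `f`. -/
lemma sum_sgn_mul_tilde {A : Type*} [CommRing A] [Algebra ℝ A] {k : ℕ} {f : Finset Ω → ℝ}
    (hf : f ∈ Harm Ω k) (u : Ω → ZMod 2) (x y : A) :
    ∑ v : Ω → ZMod 2, sgn A (∑ i, u i * v i) *
        (algebraMap ℝ A (tilde k f (supp v)) *
          x ^ (Fintype.card Ω - hammingNorm v) * y ^ hammingNorm v) =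
      algebraMap ℝ A (tilde k f (supp u)) * ((-1) ^ k * (2 * x * y) ^ k *
        ((x - y) ^ (hammingNorm u - k) * (x + y) ^ (Fintype.card Ω - hammingNorm u - k))) := by
  have hexp : ∀ v : Ω → ZMod 2, sgn A (∑ i, u i * v i) *
      (algebraMap ℝ A (tilde k f (supp v)) *
        x ^ (Fintype.card Ω - hammingNorm v) * y ^ hammingNorm v) =
      ∑ z : Finset Ω with z.card = k, algebraMap ℝ A (f z) * (sgn A (∑ i, u i * v i) *
        (if z ⊆ supp v then x ^ (Fintype.card Ω - hammingNorm v) * y ^ hammingNorm v else 0)) := by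
    intro v
    rw [tilde_eq_sum, map_sum, mul_assoc, ← Finset.filter_filter, Finset.sum_filter,
      Finset.sum_mul, Finset.mul_sum]
    refine Finset.sum_congr rfl fun z _ => ?_
    split_ifs <;> ring
  simp only [hexp]
  rw [Finset.sum_comm]
  simp only [← Finset.mul_sum, sum_sgn_mul_eq_prod, prod_eq_pow]
  calc
    _ = ∑ z : Finset Ω with z.card = k, algebraMap ℝ A (f z) *
        (fun j => (-y) ^ j * y ^ (k - j) * ((x - y) ^ (hammingNorm u - j) *
          (x + y) ^ (Fintype.card Ω - hammingNorm u - (k - j)))) (z ∩ supp u).card :=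
      Finset.sum_congr rfl fun z hz => by rw [(mem_filter.mp hz).2]
    _ = _ := sum_mul_inter_card hf (supp u) (fun j => (-y) ^ j * y ^ (k - j) *
        ((x - y) ^ (hammingNorm u - j) *
          (x + y) ^ (Fintype.card Ω - hammingNorm u - (k - j))))
    _ = _ := ?_
  -- If `f̃(u) ≠ 0`, then `k ≤ wt u` and `k ≤ n - wt u`, so the exponents involve no truncated
  -- subtraction.
  by_cases h0 : tilde k f (supp u) = 0
  · simp [h0]
  have hw : k ≤ hammingNorm u := by
    by_contra h
    exact h0 (tilde_eq_zero_of_card_lt f (by rw [card_supp]; omega))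
  have hw' : k ≤ Fintype.card Ω - hammingNorm u := by
    by_contra h
    exact h0 (tilde_eq_zero_of_card_compl_lt hf (by rw [card_compl, card_supp]; omega))
  congr 1
  -- Writing `2x = (x + y) + (x - y)` turns the sum over `j` into a binomial expansion.
  have h2x : 2 * x * y = ((x + y) + (x - y)) * y := by ring
  rw [h2x, mul_pow, add_pow, Finset.sum_mul, Finset.mul_sum, Finset.sum_mul]
  refine Finset.sum_congr rfl fun j hj => ?_
  have hj : j ≤ k := Nat.lt_succ_iff.mp (mem_range.mp hj)
  have e1 : hammingNorm u - j = (hammingNorm u - k) + (k - j) := by omega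
  have e2 : Fintype.card Ω - hammingNorm u - (k - j) =
      (Fintype.card Ω - hammingNorm u - k) + j := by omega
  have e3 : y ^ k = y ^ j * y ^ (k - j) := by rw [← pow_add, Nat.add_sub_cancel' hj]
  have e4 : ((-1) ^ k : A) = (-1) ^ (k - j) * (-1) ^ j := by rw [← pow_add, Nat.sub_add_cancel hj]
  rw [e1, e2, e3, e4, pow_add, pow_add, neg_pow y]
  ring

open Classical in
/-- Poisson summation over a binary linear code and its dual. -/
lemma sum_sum_sgn_mul {A : Type*} [CommRing A] (C : Submodule (ZMod 2) (Ω → ZMod 2))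
    (g : (Ω → ZMod 2) → A) :
    ∑ u : Ω → ZMod 2 with u ∈ C, ∑ v, sgn A (∑ i, u i * v i) * g v =
      (Nat.card C : A) * ∑ v : Ω → ZMod 2 with v ∈ dualCode C, g v := by
  rw [Finset.sum_comm, Finset.mul_sum, Finset.sum_filter]
  refine Finset.sum_congr rfl fun v _ => ?_
  rw [← Finset.sum_mul]
  split_ifs with hv
  · congr 1
    rw [Finset.sum_congr rfl (g := fun _ => 1), Finset.sum_const, nsmul_eq_mul, mul_one,
      Nat.card_eq_fintype_card, Fintype.card_subtype]
    intro u hu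
    rw [hv u (mem_filter.mp hu).2, sgn_zero]
  · suffices h : ∑ u : Ω → ZMod 2 with u ∈ C, sgn A (∑ i, u i * v i) = 0 by rw [h, zero_mul]
    obtain ⟨u₀, hu₀, h0⟩ : ∃ u₀ ∈ C, ∑ i, u₀ i * v i ≠ 0 := by
      by_contra h
      push Not at h
      exact hv h
    have hadd : ∀ u : Ω → ZMod 2, sgn A (∑ i, (u + u₀) i * v i) = - sgn A (∑ i, u i * v i) := by
      intro u
      simp only [Pi.add_apply, add_mul, Finset.sum_add_distrib, sgn_add, sgn_of_ne_zero h0]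
      ring
    -- Translation by a codeword not orthogonal to `v` flips every sign, so the terms cancel in
    -- pairs.
    refine Finset.sum_involution (fun u _ => u + u₀) ?_ ?_ ?_ ?_
    · intro u _
      rw [hadd, add_neg_cancel]
    · intro u _ _ h
      exact h0 (by rw [add_eq_left.mp h]; simp)
    · intro u hu
      simpa using C.add_mem (mem_filter.mp hu).2 hu₀
    · intro u _
      rw [add_assoc, ZModModule.add_self, add_zero]

end Transform
end RMHarm

namespace RMHarm

open Finset

/-! ### Affine functions and the extended Hamming code -/

section Affine

variable {W : Type*} [AddCommGroup W] [Module (ZMod 2) W]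

instance [Finite W] : Finite (Module.Dual (ZMod 2) W) := Module.finite_of_finite (ZMod 2)

/-- The affine function `x ↦ μ x + b`, as a binary word. -/
def affineWord (p : Module.Dual (ZMod 2) W × ZMod 2) : W → ZMod 2 := fun x => p.1 x + p.2

lemma affineWord_injective : Function.Injective (affineWord (W := W)) := by
  rintro ⟨μ, b⟩ ⟨ν, d⟩ h
  have hb : b = d := by simpa [affineWord] using congrFun h 0
  subst hb
  have : μ = ν := LinearMap.ext fun x => by simpa [affineWord] using congrFun h x
  rw [this]

lemma natCard_dual [Finite W] :
    Nat.card (Module.Dual (ZMod 2) W) = 2 ^ Module.finrank (ZMod 2) W := by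
  rw [Module.natCard_eq_pow_finrank (K := ZMod 2), Subspace.dual_finrank_eq, Nat.card_zmod]

lemma natCard_dual_prod [Finite W] :
    Nat.card (Module.Dual (ZMod 2) W × ZMod 2) = 2 ^ (Module.finrank (ZMod 2) W + 1) := by
  rw [Nat.card_prod, natCard_dual, Nat.card_zmod, pow_succ]

/-- Translation by a vector on which the linear part is nonzero exchanges support and zero set. -/
lemma two_mul_hammingNorm_affineWord [Fintype W] {p : Module.Dual (ZMod 2) W × ZMod 2}
    (hp : p.1 ≠ 0) : 2 * hammingNorm (affineWord p) = Fintype.card W := by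
  obtain ⟨w, hw⟩ : ∃ w, p.1 w ≠ 0 := by
    by_contra! h
    exact hp (LinearMap.ext h)
  have hflip : ∀ a b : ZMod 2, b ≠ 0 → (a + b ≠ 0 ↔ a = 0) := by decide
  have h : #{x | affineWord p x ≠ 0} = #{x | ¬ affineWord p x ≠ 0} := by
    refine Finset.card_equiv (Equiv.addRight w) fun x => ?_
    simp only [mem_filter, mem_univ, true_and, Equiv.coe_addRight, not_not]
    change p.1 x + p.2 ≠ 0 ↔ p.1 (x + w) + p.2 = 0
    rw [map_add, add_right_comm]
    have h2 := hflip (p.1 x + p.2 + p.1 w) (p.1 w) hw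
    rw [add_assoc, ZModModule.add_self, add_zero] at h2
    exact h2
  have := Finset.card_filter_add_card_filter_not (s := (univ : Finset W))
    (fun x => affineWord p x ≠ 0)
  rw [Finset.card_univ] at this
  have h3 : hammingNorm (affineWord p) = #{x | affineWord p x ≠ 0} := rfl
  omega

/-- In dimension above 2 two linear forms share a nonzero kernel vector; translation by it preserves
the product and pairs equal terms, which cancel in characteristic 2. -/
lemma sum_affineWord_mul_affineWord [Fintype W] (hW : 2 < Module.finrank (ZMod 2) W)
    (p q : Module.Dual (ZMod 2) W × ZMod 2) : ∑ w, affineWord p w * affineWord q w = 0 := by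
  have hker : LinearMap.ker (p.1.prod q.1) ≠ ⊥ :=
    LinearMap.ker_ne_bot_of_finrank_lt (by simpa using hW)
  obtain ⟨w₀, hw₀, hne⟩ := Submodule.exists_mem_ne_zero_of_ne_bot hker
  have h12 : p.1 w₀ = 0 ∧ q.1 w₀ = 0 := by simpa using hw₀
  refine Finset.sum_involution (fun w _ => w + w₀) ?_ ?_ ?_ ?_
  · intro w _
    simp only [affineWord, map_add, h12, add_zero]
    exact CharTwo.add_self_eq_zero _
  · intro w _ _ h
    exact hne (add_eq_left.mp h)
  · simp
  · intro w _
    rw [add_assoc, ZModModule.add_self, add_zero]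

/-- The parity checks say orthogonality to the constant `1` and to every linear form. -/
lemma affineWord_mem_extHamming [Fintype W] (hW : 2 < Module.finrank (ZMod 2) W)
    (p : Module.Dual (ZMod 2) W × ZMod 2) : affineWord p ∈ extHamming W := by
  constructor
  · have := sum_affineWord_mul_affineWord hW p (0, 1)
    simpa [affineWord] using this
  · rw [← Module.forall_dual_apply_eq_zero_iff (ZMod 2)]
    intro φ
    have := sum_affineWord_mul_affineWord hW p (φ, 0)
    simpa [affineWord, map_sum] using this

/-- The extended Hamming code is the kernel of its parity check map, which is onto. -/
lemma finrank_extHamming [Fintype W] :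
    Module.finrank (ZMod 2) (extHamming W) + (Module.finrank (ZMod 2) W + 1) =
      Fintype.card W := by
  classical
  let φ : (W → ZMod 2) →ₗ[ZMod 2] W × ZMod 2 :=
    (Fintype.linearCombination (ZMod 2) (fun w : W => w)).prod
      (Fintype.linearCombination (ZMod 2) (fun _ : W => (1 : ZMod 2)))
  have hker : LinearMap.ker φ = extHamming W := by
    ext c
    simp [φ, extHamming, Fintype.linearCombination_apply, and_comm]
  have hsurj : LinearMap.range φ = ⊤ := by
    rw [LinearMap.range_eq_top]
    rintro ⟨w, b⟩
    -- The first term maps to `(w, 1)`; the coordinate `0` then corrects the parity alone.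
    refine ⟨Pi.single w 1 + Pi.single 0 (b - 1), ?_⟩
    simp [φ, Fintype.linearCombination_apply_single]
  have := LinearMap.finrank_range_add_finrank_ker φ
  rw [hsurj, hker, finrank_top, Module.finrank_prod, Module.finrank_self,
    Module.finrank_fintype_fun_eq_card] at this
  omega

/-- Counting: the affine words lie in the code, and there are `2^4` of each, since `8 - 4 = 4`. -/
lemma exists_affineWord_eq [Fintype W] (hW : Module.finrank (ZMod 2) W = 3) {c : W → ZMod 2}
    (hc : c ∈ extHamming W) : ∃ p, affineWord p = c := by
  let g : Module.Dual (ZMod 2) W × ZMod 2 → extHamming W :=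
    fun p => ⟨affineWord p, affineWord_mem_extHamming (by omega) p⟩
  have hg : Function.Injective g := fun p q h =>
    affineWord_injective (congrArg Subtype.val h)
  have hfr := finrank_extHamming (W := W)
  rw [Module.card_eq_pow_finrank (K := ZMod 2), ZMod.card, hW] at hfr
  have hcard : Nat.card (extHamming W) ≤ Nat.card (Module.Dual (ZMod 2) W × ZMod 2) := by
    rw [natCard_dual_prod, Module.natCard_eq_pow_finrank (K := ZMod 2), Nat.card_zmod, hW]
    exact Nat.pow_le_pow_right (by norm_num) (by omega)
  obtain ⟨p, hp⟩ := (hg.bijective_of_nat_card_le hcard).2 ⟨c, hc⟩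
  exact ⟨p, congrArg Subtype.val hp⟩

/-- Restriction of linear forms is onto, and the fibres of a surjective homomorphism have equal
size. -/
lemma card_filter_dualRestrict [Finite W] [Fintype (Module.Dual (ZMod 2) W)]
    (U : Submodule (ZMod 2) W) [DecidableEq (Module.Dual (ZMod 2) U)] (μ : Module.Dual (ZMod 2) U) :
    #{ν : Module.Dual (ZMod 2) W | U.dualRestrict ν = μ} =
      2 ^ (Module.finrank (ZMod 2) W - Module.finrank (ZMod 2) U) := by
  have hsurj : Function.Surjective U.dualRestrict := Subspace.dualRestrict_surjective
  have : Fintype (Module.Dual (ZMod 2) U) := Fintype.ofFinite _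
  have hfib : ∀ μ', #{ν : Module.Dual (ZMod 2) W | U.dualRestrict ν = μ'} =
      #{ν : Module.Dual (ZMod 2) W | U.dualRestrict ν = μ} := fun μ' =>
    AddMonoidHom.card_fiber_eq_of_mem_range U.dualRestrict (hsurj μ') (hsurj μ)
  have h := Finset.card_eq_sum_card_fiberwise (f := U.dualRestrict)
    (s := (univ : Finset (Module.Dual (ZMod 2) W))) (t := univ) (by simp)
  simp only [hfib, Finset.sum_const, Finset.card_univ, ← Nat.card_eq_fintype_card, natCard_dual,
    smul_eq_mul] at h
  rw [← Nat.add_sub_cancel' (Submodule.finrank_le U), pow_add] at h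
  exact (Nat.eq_of_mul_eq_mul_left (by positivity) h).symm

end Affine

/-! ### Restriction of words to `U` -/

section Restriction

variable {V : Type*} [AddCommGroup V] [Module (ZMod 2) V]

/-- For `f` living on `U`, the value `f̃(c)` depends on the restriction of `c` to `U` only. -/
lemma tilde_supp_eq_restrict [Fintype V] {k : ℕ} {f : Finset V → ℝ} (U : Submodule (ZMod 2) V) [Fintype U]
    (hfU : ∀ z : Finset V, z.card = k → ¬ (z : Set V) ⊆ (U : Set V) → f z = 0)
    (c : V → ZMod 2) :
    tilde k f (supp c) = tilde k f
      ((supp fun w : U => c w).map (Function.Embedding.subtype (fun v => v ∈ U))) := by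
  symm
  refine Finset.sum_subset (powersetCard_mono ?_) ?_
  · intro v hv
    simp only [mem_map, mem_supp, Function.Embedding.coe_subtype] at hv ⊢
    obtain ⟨w, hw, rfl⟩ := hv
    exact hw
  · intro z hz hz'
    rw [mem_powersetCard] at hz hz'
    refine hfU z hz.2 fun hzU => hz' ⟨fun v hv => ?_, hz.2⟩
    simp only [mem_map, mem_supp, Function.Embedding.coe_subtype]
    exact ⟨⟨v, hzU hv⟩, mem_supp.mp (hz.1 hv), rfl⟩

/-- Constant words contribute nothing to a harmonic function living on `U`. -/
lemma tilde_map_supp_const [Fintype V] {k : ℕ} (hk : 1 ≤ k) {f : Finset V → ℝ} (hf : f ∈ Harm V k)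
    (U : Submodule (ZMod 2) V) [Fintype U]
    (hfU : ∀ z : Finset V, z.card = k → ¬ (z : Set V) ⊆ (U : Set V) → f z = 0) (b : ZMod 2) :
    tilde k f ((supp fun _ : U => b).map (Function.Embedding.subtype (fun v => v ∈ U))) = 0 := by
  rw [← tilde_supp_eq_restrict U hfU (fun _ => b)]
  -- The empty support has no `k`-subset as `k ≥ 1`; the full support has empty complement, so
  -- harmonicity applies.
  rcases eq_or_ne b 0 with rfl | hb
  · exact tilde_eq_zero_of_card_lt f (by simpa [supp] using Nat.pos_of_ne_zero (by omega))
  · have : (supp fun _ : V => b) = univ := by ext; simp [mem_supp, hb]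
    rw [this, tilde_univ hk hf]

open Classical in
-- On the 8 points of `U` the nonconstant affine functions are exactly the weight-4 codewords; the
-- constants contribute nothing.
lemma sum_affineWord_eq_hammingSum [Fintype V] {k : ℕ} (hk : 1 ≤ k) {f : Finset V → ℝ} (hf : f ∈ Harm V k)
    (U : Submodule (ZMod 2) V) [Fintype U] [Fintype (Module.Dual (ZMod 2) U)]
    (hU : Module.finrank (ZMod 2) U = 3)
    (hfU : ∀ z : Finset V, z.card = k → ¬ (z : Set V) ⊆ (U : Set V) → f z = 0) :
    ∑ p : Module.Dual (ZMod 2) U × ZMod 2, tilde k f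
      ((supp (affineWord p)).map (Function.Embedding.subtype (fun v => v ∈ U))) =
      hammingSum U k f := by
  have hcard : Fintype.card U = 8 := by
    rw [Module.card_eq_pow_finrank (K := ZMod 2), ZMod.card, hU]; norm_num
  rw [hammingSum, ← Finset.sum_filter_of_ne (p := fun p => p.1 ≠ 0)]
  · refine Finset.sum_bij (fun p _ => affineWord p) ?_ ?_ ?_ ?_
    · intro p hp
      have := two_mul_hammingNorm_affineWord (mem_filter.mp hp).2
      simp only [mem_filter, mem_univ, true_and]
      exact ⟨affineWord_mem_extHamming (by omega) p, by omega⟩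
    · intro p _ q _ h
      exact affineWord_injective h
    · intro a ha
      obtain ⟨-, ha, ha4⟩ := mem_filter.mp ha
      obtain ⟨⟨μ, b⟩, rfl⟩ := exists_affineWord_eq hU ha
      refine ⟨(μ, b), ?_, rfl⟩
      simp only [mem_filter, mem_univ, true_and]
      rintro rfl
      rcases eq_or_ne b 0 with rfl | hb
      · have : affineWord ((0, 0) : Module.Dual (ZMod 2) U × ZMod 2) = 0 := by
          ext; simp [affineWord]
        simp [this] at ha4
      · simp [hammingNorm, affineWord, hb, hcard] at ha4
    · intros; rfl
  · rintro ⟨μ, b⟩ - h rfl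
    have hconst : affineWord ((0, b) : Module.Dual (ZMod 2) U × ZMod 2) = fun _ => b := by
      ext; simp [affineWord]
    exact h (by rw [hconst]; exact tilde_map_supp_const hk hf U hfU b)

open Classical in
-- Group the linear forms on `V` by their restriction to `U`: `f̃` is constant on each fibre, and
-- every fibre has `2^(dim V - 3)` elements.
lemma sum_tilde_affineWord [Fintype V] {k : ℕ} (hk : 1 ≤ k) {f : Finset V → ℝ} (hf : f ∈ Harm V k)
    (U : Submodule (ZMod 2) V) [Fintype U] [Fintype (Module.Dual (ZMod 2) V)]
    (hU : Module.finrank (ZMod 2) U = 3)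
    (hfU : ∀ z : Finset V, z.card = k → ¬ (z : Set V) ⊆ (U : Set V) → f z = 0) :
    ∑ p : Module.Dual (ZMod 2) V × ZMod 2, tilde k f (supp (affineWord p)) =
      2 ^ (Module.finrank (ZMod 2) V - 3) * hammingSum U k f := by
  have : Fintype (Module.Dual (ZMod 2) U) := Fintype.ofFinite _
  rw [← sum_affineWord_eq_hammingSum hk hf U hU hfU, Fintype.sum_prod_type_right,
    Fintype.sum_prod_type_right, Finset.mul_sum]
  refine Finset.sum_congr rfl fun b _ => ?_
  have hres : ∀ ν : Module.Dual (ZMod 2) V, tilde k f (supp (affineWord (ν, b))) =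
      tilde k f ((supp (affineWord (U.dualRestrict ν, b))).map
        (Function.Embedding.subtype (fun v => v ∈ U))) := fun ν =>
    tilde_supp_eq_restrict U hfU _
  simp only [hres]
  rw [← Finset.sum_fiberwise (g := U.dualRestrict), Finset.mul_sum]
  refine Finset.sum_congr rfl fun μ _ => ?_
  rw [← hU, Finset.sum_congr rfl (fun ν hν => by rw [(mem_filter.mp hν).2]), Finset.sum_const,
    card_filter_dualRestrict, nsmul_eq_mul]
  norm_num

lemma tilde_supp_affineWord_eq_zero [Fintype V] {k : ℕ} (hk : 1 ≤ k) {f : Finset V → ℝ} (hf : f ∈ Harm V k)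
    (U : Submodule (ZMod 2) V) [Fintype U]
    (hfU : ∀ z : Finset V, z.card = k → ¬ (z : Set V) ⊆ (U : Set V) → f z = 0)
    {p : Module.Dual (ZMod 2) V × ZMod 2} (hp : p.1 = 0) :
    tilde k f (supp (affineWord p)) = 0 := by
  rw [tilde_supp_eq_restrict U hfU]
  have := tilde_map_supp_const hk hf U hfU p.2
  simpa [affineWord, hp] using this

lemma hammingSum_eq_zero {k : ℕ} (hk : 4 < k) (f : Finset V → ℝ) (U : Submodule (ZMod 2) V)
    [Fintype U] : hammingSum U k f = 0 := by
  classical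
  refine Finset.sum_eq_zero fun a ha => tilde_eq_zero_of_card_lt f ?_
  rw [card_map, card_supp, (mem_filter.mp ha).2.2]
  exact hk

end Restriction

/-! ### Parametrisation of `RM(1,m)` by affine functions -/

section ReedMuller

variable {m : ℕ}

lemma sum_RM1 [Fintype (Module.Dual (ZMod 2) (Fin m → ZMod 2))] {A : Type*} [AddCommMonoid A]
    {S : Finset ((Fin m → ZMod 2) → ZMod 2)} (hS : ∀ c, c ∈ S ↔ c ∈ RM1 m)
    (F : ((Fin m → ZMod 2) → ZMod 2) → A) :
    ∑ c ∈ S, F c = ∑ p, F (affineWord p) := by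
  symm
  refine Finset.sum_bij (fun p _ => affineWord p) ?_ ?_ ?_ ?_
  · exact fun p _ => (hS _).mpr ⟨p.1, p.2, rfl⟩
  · exact fun p _ q _ h => affineWord_injective h
  · intro c hc
    obtain ⟨μ, b, rfl⟩ := (hS c).mp hc
    exact ⟨(μ, b), mem_univ _, rfl⟩
  · intros; rfl

lemma natCard_RM1 : Nat.card (RM1 m) = 2 ^ (m + 1) := by
  have e : Module.Dual (ZMod 2) (Fin m → ZMod 2) × ZMod 2 ≃ RM1 m :=
    Equiv.ofBijective (fun p => ⟨affineWord p, p.1, p.2, rfl⟩)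
      ⟨fun p q h => affineWord_injective (congrArg Subtype.val h),
        fun ⟨_, μ, b, h⟩ => ⟨(μ, b), Subtype.ext h.symm⟩⟩
  rw [← Nat.card_congr e, natCard_dual_prod, Module.finrank_fin_fun]

end ReedMuller

end RMHarm

/-! ### MacWilliams identity and the two enumerators -/

namespace RMHarm

open Finset MvPolynomial

lemma sq_add_mul_sq_sub (a b : MvPolynomial (Fin 2) ℝ) (n : ℕ) :
    (C (1 / Real.sqrt 2) * a) ^ n * (C (1 / Real.sqrt 2) * b) ^ n =
      C ((1 / 2) ^ n) * (a * b) ^ n := by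
  have h : (1 / Real.sqrt 2) * (1 / Real.sqrt 2) = 1 / 2 := by
    rw [div_mul_div_comm, one_mul, Real.mul_self_sqrt zero_le_two]
  rw [← mul_pow, mul_mul_mul_comm, ← C_mul, h, mul_pow, C_pow]

open Classical in
/-- The MacWilliams identity for harmonic weight enumerators. -/
lemma natCard_mul_harmWE_dualCode {Ω : Type*} [Fintype Ω] {k : ℕ} {f : Finset Ω → ℝ}
    (hf : f ∈ Harm Ω k) (D : Submodule (ZMod 2) (Ω → ZMod 2)) :
    (Nat.card D : MvPolynomial (Fin 2) ℝ) * harmWE (dualCode D) k f =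
      ∑ c : Ω → ZMod 2 with c ∈ D, C (tilde k f (supp c)) * ((-1) ^ k * (2 * X 0 * X 1) ^ k *
        ((X 0 - X 1) ^ (hammingNorm c - k) *
          (X 0 + X 1) ^ (Fintype.card Ω - hammingNorm c - k))) := by
  have h := sum_sum_sgn_mul D
    (fun v => algebraMap ℝ (MvPolynomial (Fin 2) ℝ) (tilde k f (supp v)) *
      X 0 ^ (Fintype.card Ω - hammingNorm v) * X 1 ^ hammingNorm v)
  simp only [sum_sgn_mul_tilde hf] at h
  exact h.symm

end RMHarm

open MvPolynomial in
theorem theorem1p2 (m k : ℕ) (hk : 1 ≤ k)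
    (U : Submodule (ZMod 2) (Fin m → ZMod 2)) [Fintype U]
    (hU : Module.finrank (ZMod 2) U = 3)
    (f : Finset (Fin m → ZMod 2) → ℝ) (hf : f ∈ RMHarm.Harm (Fin m → ZMod 2) k)
    (hfU : ∀ z : Finset (Fin m → ZMod 2),
      z.card = k → ¬ (z : Set (Fin m → ZMod 2)) ⊆ (U : Set (Fin m → ZMod 2)) → f z = 0) :
    RMHarm.harmWE (RMHarm.RM1 m) k f =
        MvPolynomial.C (2 ^ (m - 3)) *
          MvPolynomial.X 0 ^ (2 ^ (m - 1)) * MvPolynomial.X 1 ^ (2 ^ (m - 1)) *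
          MvPolynomial.C (RMHarm.hammingSum U k f) ∧
      RMHarm.harmWE (RMHarm.dualCode (RMHarm.RM1 m)) k f =
        (-1) ^ k * (MvPolynomial.X 0 * MvPolynomial.X 1) ^ k *
          MvPolynomial.C (2 ^ (2 ^ (m - 1) - 4)) *
          (MvPolynomial.C (1 / Real.sqrt 2) *
            (MvPolynomial.X 0 + MvPolynomial.X 1)) ^ (2 ^ (m - 1) - k) *
          (MvPolynomial.C (1 / Real.sqrt 2) *
            (MvPolynomial.X 0 - MvPolynomial.X 1)) ^ (2 ^ (m - 1) - k) *
          MvPolynomial.C (RMHarm.hammingSum U k f) := by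
  classical
  have : Fintype (Module.Dual (ZMod 2) (Fin m → ZMod 2)) := Fintype.ofFinite _
  have hm : 3 ≤ m := by
    have := Submodule.finrank_le U
    rwa [hU, Module.finrank_fin_fun] at this
  obtain ⟨n, rfl⟩ : ∃ n, m = n + 3 := ⟨m - 3, by omega⟩
  rw [show n + 3 - 1 = n + 2 by omega, Nat.add_sub_cancel]
  have hcard : Fintype.card (Fin (n + 3) → ZMod 2) = 2 ^ (n + 2) + 2 ^ (n + 2) := by
    rw [Fintype.card_fun, ZMod.card, Fintype.card_fin]; ring
  have hN : 4 ≤ 2 ^ (n + 2) := by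
    have := Nat.one_le_two_pow (n := n)
    rw [pow_add]; omega
  have hwt : ∀ p : Module.Dual (ZMod 2) (Fin (n + 3) → ZMod 2) × ZMod 2, p.1 ≠ 0 →
      hammingNorm (RMHarm.affineWord p) = 2 ^ (n + 2) := fun p hp => by
    have := RMHarm.two_mul_hammingNorm_affineWord hp
    omega
  have hsum := RMHarm.sum_tilde_affineWord hk hf U hU hfU
  rw [Module.finrank_fin_fun, Nat.add_sub_cancel] at hsum
  /- only the words of weight `2 ^ (n + 2)` contribute -/
  have hcollect : ∀ (F : ℕ → MvPolynomial (Fin 2) ℝ)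
      (S : Finset ((Fin (n + 3) → ZMod 2) → ZMod 2)), (∀ c, c ∈ S ↔ c ∈ RMHarm.RM1 (n + 3)) →
      ∑ c ∈ S, C (RMHarm.tilde k f (RMHarm.supp c)) * F (hammingNorm c) =
        C (2 ^ n * RMHarm.hammingSum U k f) * F (2 ^ (n + 2)) := fun F S hS => by
    rw [← hsum, map_sum, Finset.sum_mul, RMHarm.sum_RM1 hS]
    refine Finset.sum_congr rfl fun p _ => ?_
    by_cases hp : p.1 = 0
    · rw [RMHarm.tilde_supp_affineWord_eq_zero hk hf U hfU hp]; simp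
    · rw [hwt p hp]
  constructor
  · rw [RMHarm.harmWE]
    simp only [mul_assoc]
    refine (hcollect (fun w => X 0 ^ (Fintype.card (Fin (n + 3) → ZMod 2) - w) * X 1 ^ w) _
      (by simp)).trans ?_
    rw [hcard, Nat.add_sub_cancel, C_mul]
    ring
  · have h2 : (2 : MvPolynomial (Fin 2) ℝ) ≠ 0 := two_ne_zero
    -- The factor `2 ^ (n + 4)` is the order of `RM(1, n + 3)`, as in the MacWilliams identity.
    refine mul_left_cancel₀ (pow_ne_zero (n + 4) h2) ?_
    have hdual := RMHarm.natCard_mul_harmWE_dualCode hf (RMHarm.RM1 (n + 3))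
    rw [RMHarm.natCard_RM1, Nat.cast_pow, Nat.cast_ofNat] at hdual
    refine hdual.trans ((hcollect (fun w => (-1) ^ k * (2 * X 0 * X 1) ^ k *
      ((X 0 - X 1) ^ (w - k) * (X 0 + X 1) ^ (Fintype.card (Fin (n + 3) → ZMod 2) - w - k))) _
      (by simp)).trans ?_)
    -- For `k > 4` both sides vanish, so truncation in `2 ^ (n + 2) - k` is harmless; otherwise `k ≤
    -- 4 ≤ 2 ^ (n + 2)`.
    rcases Nat.lt_or_ge 4 k with h4 | h4
    · simp [RMHarm.hammingSum_eq_zero h4]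
    rw [hcard, Nat.add_sub_cancel, mul_assoc ((-1) ^ k * _ * _) _ (_ ^ (2 ^ (n + 2) - k)),
      RMHarm.sq_add_mul_sq_sub]
    obtain ⟨M, hM⟩ : ∃ M, 2 ^ (n + 2) = M + 4 := ⟨2 ^ (n + 2) - 4, by omega⟩
    obtain ⟨j, hj⟩ : ∃ j, 4 = k + j := ⟨4 - k, by omega⟩
    have e1 : M + 4 - k = M + j := by omega
    rw [hM, e1, Nat.add_sub_cancel]
    -- Balance of powers of two: code order, stated prefactor and the paired `1 / √2` on the left;
    -- the fibre size `2 ^ n` and the `2 ^ k` from `(2xy)^k` on the right. They agree because `k + j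
    -- = 4`.
    have hconst : (2 : ℝ) ^ (n + 4) * 2 ^ M * (1 / 2) ^ (M + j) = 2 ^ n * 2 ^ k := by
      rw [hj, one_div, inv_pow, mul_inv_eq_iff_eq_mul₀ (by positivity)]
      ring
    have hC := congrArg (C (σ := Fin 2)) hconst
    simp only [C_mul, C_pow, map_ofNat] at hC ⊢
    rw [mul_pow (X 0 + X 1), mul_assoc 2, mul_pow 2]
    linear_combination (-(-1) ^ k * (X 0 * X 1) ^ k * (X 0 + X 1) ^ (M + j) *
      (X 0 - X 1) ^ (M + j) * C (RMHarm.hammingSum U k f)) * hC
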